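/- Let $\alpha\in(1,\infty)$, let $n\ge 4$ be an integer and let $k\in\{1,\dots,n-3\}$. For a Borel probability measure $\nu$ on the space $\mathsf M_{k\times(n-1)}(\mathbb R)$ of real $k\times(n-1)$ matrices put $$\mathfrak p_\nu^\alpha=\inf_{z\in\mathbb R^{n-1},\ \|z\|_2=1}\nu\big[\{A\in\mathsf M_{k\times(n-1)}(\mathbb R):\ 1\le\|Az\|_2\le\alpha\}\big],$$ where $\|\cdot\|_2$ denotes the Euclidean norm, and let $\mathfrak p_{n,k}^\alpha$ be the supremum of $\mathfrak p_\nu^\alpha$ over all Borel probability measures $\nu$ on $\mathsf M_{k\times(n-1)}(\mathbb R)$. Let $$\sigma_{\max}=\sqrt{\frac{\alpha^{\frac{2n-6}{n-k-3}}-1}{\alpha^{\frac{2k}{n-k-3}}-1}}\quad\text{if } k\le n-4,\qquad \sigma_{\max}=\alpha\quad\text{if } k=n-3 .$$ (The value for $k=n-3$ is the limit of the displayed formula as $n-k-3$, regarded as a real variable with $k$ fixed, decreases to $0$.) Let $\mathrm{Proj}_{\mathbb R^k}\in\mathsf M_{k\times(n-1)}(\mathbb R)$ be the matrix of the projection $(z_1,\dots,z_{n-1})\mapsto(z_1,\dots,z_k)$,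 and let $\mu$ be the distribution of the random matrix $\sigma_{\max}\,\mathrm{Proj}_{\mathbb R^k}O$, where $O$ is distributed according to the normalized Haar measure on the group $\mathsf O_{n-1}$ of $(n-1)\times(n-1)$ orthogonal matrices. Then $\mu$ is a Borel probability measure and $\mathfrak p_\mu^\alpha=\mathfrak p_{n,k}^\alpha$; that is, the supremum defining $\mathfrak p_{n,k}^\alpha$ is attained at $\mu$. -/

import Mathlib

open MeasureTheory
open scoped ENNReal Matrix

namespace JLOptimal

/-- The space of real matrices carries its Borel σ-algebra. -/
instance instMeasurableSpaceMatrix {p q : Type*} : MeasurableSpace (Matrix p q ℝ) :=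
  borel (Matrix p q ℝ)

instance instBorelSpaceMatrix {p q : Type*} : BorelSpace (Matrix p q ℝ) := ⟨rfl⟩

/-- The orthogonal group `O_m` is compact. -/
instance instCompactSpaceOrthogonalGroup (m : ℕ) :
    CompactSpace (Matrix.orthogonalGroup (Fin m) ℝ) := by
  have hK : IsCompact (Set.pi Set.univ fun _ : Fin m => Set.pi Set.univ
      fun _ : Fin m => Set.Icc (-1 : ℝ) 1) :=
    isCompact_univ_pi fun _ => isCompact_univ_pi fun _ => isCompact_Icc
  have hcl : IsClosed (Matrix.orthogonalGroup (Fin m) ℝ : Set (Matrix (Fin m) (Fin m) ℝ)) :=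
    isClosed_unitary
  refine isCompact_iff_compactSpace.mp (hK.of_isClosed_subset hcl ?_)
  intro U hU i _ j _
  have h := entry_norm_bound_of_unitary (𝕜 := ℝ) (U := U) hU i j
  rw [Real.norm_eq_abs, abs_le] at h
  exact h

/-- The Haar measure on the orthogonal group `O_m`, normalized to have total mass `1`. -/
noncomputable def haarOrthogonal (m : ℕ) : Measure (Matrix.orthogonalGroup (Fin m) ℝ) :=
  Measure.haarMeasure ⊤

instance instIsHaarMeasureHaarOrthogonal (m : ℕ) : (haarOrthogonal m).IsHaarMeasure := by
  unfold haarOrthogonal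
  infer_instance

instance instIsProbabilityMeasureHaarOrthogonal (m : ℕ) :
    IsProbabilityMeasure (haarOrthogonal m) :=
  ⟨by simpa [haarOrthogonal] using
    (Measure.haarMeasure_self (K₀ := (⊤ : TopologicalSpace.PositiveCompacts
      (Matrix.orthogonalGroup (Fin m) ℝ))))⟩

/-- The `k × m` matrix of the projection onto the first `k` coordinates. -/
def projMatrix (k m : ℕ) : Matrix (Fin k) (Fin m) ℝ :=
  Matrix.of fun i j => if (i : ℕ) = (j : ℕ) then 1 else 0

/-- The worst-case success probability of a measure `μ` on `k × m` matrices: the infimum over unit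
vectors `z` of the `μ`-measure of the matrices `A` with `1 ≤ ‖A z‖₂ ≤ α`. -/
noncomputable def worstCaseProb {k m : ℕ} (α : ℝ) (μ : Measure (Matrix (Fin k) (Fin m) ℝ)) :
    ℝ≥0∞ :=
  ⨅ z ∈ Metric.sphere (0 : EuclideanSpace ℝ (Fin m)) 1,
    μ {A | 1 ≤ ‖Matrix.toEuclideanLin A z‖ ∧ ‖Matrix.toEuclideanLin A z‖ ≤ α}

/-- The best worst-case success probability over all Borel probability measures on `k × m`
matrices. -/
noncomputable def optimalProb (k m : ℕ) (α : ℝ) : ℝ≥0∞ :=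
  ⨆ (ν : Measure (Matrix (Fin k) (Fin m) ℝ)) (_ : IsProbabilityMeasure ν), worstCaseProb α ν

/-- The scaling factor. When `n = k + 3` the exponents `(2n-6)/(n-k-3)` and `2k/(n-k-3)` have a
zero denominator, and the formula is read as its limit as `n - k - 3` decreases to `0`,
which is `α`. -/
noncomputable def sigmaMax (n k : ℕ) (α : ℝ) : ℝ :=
  if n = k + 3 then α
  else Real.sqrt ((α ^ ((2 * (n : ℝ) - 6) / ((n : ℝ) - k - 3)) - 1) /
    (α ^ ((2 * (k : ℝ)) / ((n : ℝ) - k - 3)) - 1))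

/-- The law of `sigmaMax · Proj · O` for a Haar-distributed `O` in `O_{n-1}`. -/
noncomputable def scaledProjLaw (n k : ℕ) (α : ℝ) : Measure (Matrix (Fin k) (Fin (n - 1)) ℝ) :=
  (haarOrthogonal (n - 1)).map fun O : Matrix.orthogonalGroup (Fin (n - 1)) ℝ =>
    sigmaMax n k α • (projMatrix k (n - 1) * (O : Matrix (Fin (n - 1)) (Fin (n - 1)) ℝ))

end JLOptimal

/-! A worst-case probability is at most an average over random rotations of the test vector. By
Tonelli (`worstCaseProb_le`), that average is at most the best probability `1 ≤ ‖A O z‖ ≤ α` for a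
single matrix `A` and Haar-random `O`. For fixed `A`, this probability is the share of the unit ball
lying in the cone `‖x‖ ≤ ‖A x‖ ≤ α ‖x‖`, whatever the unit vector `z`
(`haarOrthogonal_stretchCone`). It remains to show that the scaled projection maximizes the cone
volume.

Write `n - 1 = k + (N + 2)`. Every `A` factors through an orthogonal projection onto `ℝ^k` followed
by some `u`. Polar coordinates in both factors turn the cone volume into an integral over unit `θ ∈
ℝ^k` of a function of `c = ‖u θ‖` alone (`volume_stretchCone`). At fixed `ρ = ‖x‖`, that function
integrates `p^(k-1) (ρ² - p²)^(N/2)` over the window `[ρ/c, α ρ/c]`. The best window starts at `ρ /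
sigmaMax` for every `ρ` (`radialVolume_le`), so the constant choice `c = sigmaMax` is optimal for
all `θ` at once. -/

namespace JLOptimal

open Set

/-! ### The optimal window `[t, α t]` for a weight on the half-line -/

/-- Scaling the variable in a Lebesgue integral over an interval. -/
theorem setLIntegral_Ioc_mul_left {ψ : ℝ → ℝ≥0∞} {α : ℝ} (hα : 0 < α) (a b : ℝ) :
    ∫⁻ p in Ioc (α * a) (α * b), ψ p = ∫⁻ p in Ioc a b, ENNReal.ofReal α * ψ (α * p) := by
  have h := lintegral_image_eq_lintegral_abs_deriv_mul (s := Ioc a b) (f := fun p => α * p)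
    (f' := fun _ => α) measurableSet_Ioc
    (fun x _ => by simpa using ((hasDerivAt_id x).const_mul α).hasDerivWithinAt)
    (fun x _ y _ hxy => mul_left_cancel₀ hα.ne' hxy) ψ
  rw [image_mul_left_Ioc hα, abs_of_pos hα] at h
  exact h

theorem setLIntegral_Ioc_add {ψ : ℝ → ℝ≥0∞} {a b c : ℝ} (hab : a ≤ b) (hbc : b ≤ c) :
    (∫⁻ p in Ioc a b, ψ p) + ∫⁻ p in Ioc b c, ψ p = ∫⁻ p in Ioc a c, ψ p := by
  rw [← Ioc_union_Ioc_eq_Ioc hab hbc, lintegral_union measurableSet_Ioc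
    (Ioc_disjoint_Ioc_of_le le_rfl)]

/-- Among the intervals `[t, α t]`, the weight `ψ` is maximal for `t = s`, if `p ψ(p)` compares
with `α p ψ(α p)` in one direction below `s` and in the other direction above `s`. -/
theorem setLIntegral_Icc_mul_le {ψ : ℝ → ℝ≥0∞} {α s t : ℝ} (hα : 1 < α) (hs : 0 < s) (ht : 0 < t)
    {C : ℝ≥0∞} (hC : C ≠ ∞) (hb : ∀ p, 0 < p → ψ p ≤ C)
    (h₁ : ∀ p, 0 < p → p ≤ s → ψ p ≤ ENNReal.ofReal α * ψ (α * p))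
    (h₂ : ∀ p, s < p → ENNReal.ofReal α * ψ (α * p) ≤ ψ p) :
    ∫⁻ p in Icc t (α * t), ψ p ≤ ∫⁻ p in Icc s (α * s), ψ p := by
  have hα0 : 0 < α := one_pos.trans hα
  have hfin : ∀ a b : ℝ, 0 < a → ∫⁻ p in Ioc a b, ψ p ≠ ∞ := fun a b ha => by
    refine ne_top_of_le_ne_top ?_ (setLIntegral_mono measurable_const
      fun p hp => hb p (ha.trans hp.1))
    simpa using ENNReal.mul_ne_top hC (by simp)
  have hlt : ∀ x : ℝ, 0 < x → x ≤ α * x := fun x hx => le_mul_of_one_le_left hx.le hα.le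
  rw [← restrict_Ioc_eq_restrict_Icc, ← restrict_Ioc_eq_restrict_Icc]
  rcases le_or_gt t s with hts | hst
  · have hαts : α * t ≤ α * s := by gcongr
    -- Splitting `(t, α s]` at `α t` and at `s` avoids deciding which of these is larger; cancelling
    -- then needs finite integrals.
    have e := (setLIntegral_Ioc_add (ψ := ψ) (hlt t ht) hαts).trans
      (setLIntegral_Ioc_add (ψ := ψ) hts (hlt s hs)).symm
    have hle : ∫⁻ p in Ioc t s, ψ p ≤ ∫⁻ p in Ioc (α * t) (α * s), ψ p := by
      rw [setLIntegral_Ioc_mul_left hα0]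
      exact setLIntegral_mono' measurableSet_Ioc fun p hp => h₁ p (ht.trans hp.1) hp.2
    refine (ENNReal.add_le_add_iff_right (hfin (α * t) (α * s) (by positivity))).1 ?_
    rw [e, add_comm]
    gcongr
  · have hαst : α * s ≤ α * t := by gcongr
    have e := (setLIntegral_Ioc_add (ψ := ψ) (hlt s hs) hαst).trans
      (setLIntegral_Ioc_add (ψ := ψ) hst.le (hlt t ht)).symm
    have hle : ∫⁻ p in Ioc (α * s) (α * t), ψ p ≤ ∫⁻ p in Ioc s t, ψ p := by
      rw [setLIntegral_Ioc_mul_left hα0]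
      exact setLIntegral_mono' measurableSet_Ioc fun p hp => h₂ p hp.1
    refine (ENNReal.add_le_add_iff_left (hfin s t hs)).1 ?_
    rw [← e, add_comm]
    gcongr

/-- With `γ = α^(k/N)`, the factor `α^k` enters the `N`-th power, and the comparison becomes `ρ² -
p² ≤ γ² (ρ² - α² p²)`. This is linear in `p²` and changes sign exactly at `p = ρ / sigmaMax`. For `N
= 0` the only threshold is `α p = ρ`. -/
theorem sigmaMax_pos_and_compare {α : ℝ} (hα : 1 < α) {k : ℕ} (hk : 1 ≤ k) (N : ℕ) :
    0 < sigmaMax (k + N + 3) k α ∧ ∀ ρ p : ℝ, 0 < ρ → 0 < p →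
      (p ≤ ρ / sigmaMax (k + N + 3) k α →
        α * p ≤ ρ ∧ √(ρ ^ 2 - p ^ 2) ^ N ≤ α ^ k * √(ρ ^ 2 - (α * p) ^ 2) ^ N) ∧
      (ρ / sigmaMax (k + N + 3) k α < p → α * p ≤ ρ →
        α ^ k * √(ρ ^ 2 - (α * p) ^ 2) ^ N ≤ √(ρ ^ 2 - p ^ 2) ^ N) := by
  have hα0 : 0 < α := one_pos.trans hα
  rcases Nat.eq_zero_or_pos N with rfl | hN
  · have hσ : sigmaMax (k + 0 + 3) k α = α := by simp [sigmaMax]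
    rw [hσ]
    refine ⟨hα0, fun ρ p hρ hp => ⟨fun h => ⟨?_, ?_⟩, fun h h' => ?_⟩⟩
    · rwa [le_div_iff₀ hα0, mul_comm] at h
    · simpa using one_le_pow₀ hα.le
    · rw [div_lt_iff₀ hα0] at h
      linarith
  · have hN' : (0 : ℝ) < N := by exact_mod_cast hN
    have hk' : (0 : ℝ) < k := by exact_mod_cast hk
    obtain ⟨γ, hγdef⟩ : ∃ γ : ℝ, γ = α ^ ((k : ℝ) / N) := ⟨_, rfl⟩
    have hγ1 : 1 < γ := hγdef ▸ Real.one_lt_rpow hα (by positivity)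
    have hγN : γ ^ N = α ^ k := by
      rw [hγdef, ← Real.rpow_mul_natCast hα0.le, div_mul_cancel₀ _ hN'.ne', Real.rpow_natCast]
    have hγ2 : α ^ ((2 * (k : ℝ)) / N) = γ ^ 2 := by
      rw [hγdef, ← Real.rpow_mul_natCast hα0.le]
      congr 1
      push_cast
      ring
    have hγα : α ^ ((2 * ((k : ℝ) + N)) / N) = γ ^ 2 * α ^ 2 := by
      rw [← hγ2, ← Real.rpow_natCast α 2, ← Real.rpow_add hα0]
      congr 1
      push_cast
      field_simp
    have hσ : sigmaMax (k + N + 3) k α = √((γ ^ 2 * α ^ 2 - 1) / (γ ^ 2 - 1)) := by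
      have hne : ¬ k + N + 3 = k + 3 := by omega
      have e1 : (2 * ((k + N + 3 : ℕ) : ℝ) - 6) = 2 * ((k : ℝ) + N) := by push_cast; ring
      have e2 : (((k + N + 3 : ℕ) : ℝ) - k - 3) = N := by push_cast; ring
      rw [sigmaMax, if_neg hne, e1, e2, hγ2, hγα]
    have hd : 0 < γ ^ 2 - 1 := by nlinarith
    have hn : 0 < γ ^ 2 * α ^ 2 - 1 := by
      have : 1 < γ ^ 2 * α ^ 2 := one_lt_mul_of_lt_of_le (by nlinarith) (by nlinarith)
      linarith
    obtain ⟨σ, hσ'⟩ : ∃ σ, σ = sigmaMax (k + N + 3) k α := ⟨_, rfl⟩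
    rw [← hσ'] at hσ ⊢
    have hσ0 : 0 < σ := hσ ▸ Real.sqrt_pos.2 (div_pos hn hd)
    have hσsq : σ ^ 2 * (γ ^ 2 - 1) = γ ^ 2 * α ^ 2 - 1 := by
      rw [hσ, Real.sq_sqrt (div_pos hn hd).le, div_mul_cancel₀ _ hd.ne']
    -- This keeps `α p` inside the sphere of radius `ρ` whenever `p ≤ ρ / σ`.
    have hασ : α ≤ σ := by
      refine le_of_sq_le_sq ?_ hσ0.le
      nlinarith
    have hmul : ∀ y : ℝ, α ^ k * y ^ N = (γ * y) ^ N := fun y => by rw [mul_pow, hγN]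
    refine ⟨hσ0, fun ρ p hρ hp => ⟨fun h => ?_, fun h h' => ?_⟩⟩
    · rw [le_div_iff₀ hσ0] at h
      have hαp : α * p ≤ ρ := by nlinarith
      refine ⟨hαp, ?_⟩
      rw [hmul]
      have hsq : (p * σ) ^ 2 ≤ ρ ^ 2 := by gcongr
      refine pow_le_pow_left₀ (Real.sqrt_nonneg _) ?_ N
      rw [← Real.sqrt_sq (by positivity : 0 ≤ γ), ← Real.sqrt_mul (by positivity)]
      refine Real.sqrt_le_sqrt ?_
      nlinarith
    · rw [div_lt_iff₀ hσ0] at h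
      rw [hmul]
      have hsq : ρ ^ 2 ≤ (p * σ) ^ 2 := by gcongr
      refine pow_le_pow_left₀ (by positivity) ?_ N
      rw [← Real.sqrt_sq (by positivity : 0 ≤ γ), ← Real.sqrt_mul (by positivity)]
      refine Real.sqrt_le_sqrt ?_
      nlinarith

/-! ### Maximizing the radial volume -/

/-- The substitution `ρ = √(p² + q²)`. -/
theorem lintegral_sqrt_add_sq (N : ℕ) {p : ℝ} (hp : 0 < p) (h : ℝ → ℝ≥0∞) :
    ∫⁻ q in Ioi (0 : ℝ), ENNReal.ofReal (q ^ (N + 1)) * h √(p ^ 2 + q ^ 2) =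
      ∫⁻ ρ in Ioi p, ENNReal.ofReal (ρ * √(ρ ^ 2 - p ^ 2) ^ N) * h ρ := by
  have hpos : ∀ ρ ∈ Ioi p, 0 < ρ ^ 2 - p ^ 2 := fun ρ hρ => by
    have : p < ρ := hρ
    nlinarith
  have himg : (fun ρ : ℝ => √(ρ ^ 2 - p ^ 2)) '' Ioi p = Ioi 0 := by
    ext q
    constructor
    · rintro ⟨ρ, hρ, rfl⟩
      exact Real.sqrt_pos.2 (hpos ρ hρ)
    · intro hq
      have hq : 0 < q := hq
      refine ⟨√(p ^ 2 + q ^ 2), Real.lt_sqrt_of_sq_lt (by nlinarith), ?_⟩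
      simp only
      rw [Real.sq_sqrt (by positivity), add_sub_cancel_left, Real.sqrt_sq hq.le]
  have key := lintegral_image_eq_lintegral_abs_deriv_mul (s := Ioi p)
    (f := fun ρ => √(ρ ^ 2 - p ^ 2)) (f' := fun ρ => ρ / √(ρ ^ 2 - p ^ 2)) measurableSet_Ioi
    (fun ρ hρ => by
      have := (((hasDerivAt_pow 2 ρ).sub_const (p ^ 2)).sqrt (hpos ρ hρ).ne').hasDerivWithinAt
        (s := Ioi p)
      refine this.congr_deriv ?_
      rw [pow_one, Nat.cast_ofNat, mul_div_mul_left _ _ two_ne_zero])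
    (fun x hx y hy hxy => by
      have hx' : p < x := hx
      have hy' : p < y := hy
      have := (Real.sqrt_inj (hpos x hx).le (hpos y hy).le).1 hxy
      exact (sq_eq_sq₀ (by linarith) (by linarith)).1 (by linarith))
    (fun q => ENNReal.ofReal (q ^ (N + 1)) * h √(p ^ 2 + q ^ 2))
  rw [himg] at key
  rw [key]
  refine setLIntegral_congr_fun measurableSet_Ioi fun ρ hρ => ?_
  have hρ0 : 0 < ρ := hp.trans hρ
  have hs := Real.sqrt_pos.2 (hpos ρ hρ)
  rw [Real.sq_sqrt (hpos ρ hρ).le, add_sub_cancel, Real.sqrt_sq hρ0.le, ← mul_assoc,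
    abs_of_pos (by positivity), ← ENNReal.ofReal_mul (by positivity)]
  -- The Jacobian `ρ / q` uses up one of the `N + 1` factors `q`.
  congr 2
  field_simp
  rw [pow_succ']

/-- The indicator of `s ≤ 1`, `s ≤ v ≤ α s`. -/
noncomputable def coneInd (α v s : ℝ) : ℝ≥0∞ :=
  {x : ℝ × ℝ | x.2 ≤ 1 ∧ x.2 ≤ x.1 ∧ x.1 ≤ α * x.2}.indicator 1 (v, s)

theorem measurable_coneInd (α : ℝ) : Measurable fun x : ℝ × ℝ => coneInd α x.1 x.2 := by
  unfold coneInd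
  refine measurable_one.indicator ?_
  refine (IsClosed.and ?_ (IsClosed.and ?_ ?_)).measurableSet
  · exact isClosed_le continuous_snd continuous_const
  · exact isClosed_le continuous_snd continuous_fst
  · exact isClosed_le continuous_fst (by fun_prop)

/-- The radial part, in polar coordinates in both factors of `ℝ^k × ℝ^(N+2)`, of the volume of the
points `x` of the unit ball whose first component `y` satisfies `‖x‖ ≤ c ‖y‖ ≤ α ‖x‖`. -/
noncomputable def radialVolume (k N : ℕ) (α c : ℝ) : ℝ≥0∞ :=
  ∫⁻ p in Ioi (0 : ℝ), ENNReal.ofReal (p ^ (k - 1)) *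
    ∫⁻ q in Ioi (0 : ℝ), ENNReal.ofReal (q ^ (N + 1)) * coneInd α (c * p) √(p ^ 2 + q ^ 2)

/-- The weight of radius `p` on the sphere of radius `ρ`. -/
noncomputable def sliceWeight (k N : ℕ) (ρ p : ℝ) : ℝ≥0∞ :=
  {x : ℝ × ℝ | x.2 ≤ x.1}.indicator
    (fun x => ENNReal.ofReal (x.2 ^ (k - 1) * √(x.1 ^ 2 - x.2 ^ 2) ^ N)) (ρ, p)

theorem measurable_sliceWeight (k N : ℕ) :
    Measurable fun x : ℝ × ℝ => sliceWeight k N x.1 x.2 := by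
  unfold sliceWeight
  exact Measurable.indicator (by fun_prop) (isClosed_le continuous_snd continuous_fst).measurableSet

theorem sliceWeight_of_le {k N : ℕ} {ρ p : ℝ} (h : p ≤ ρ) :
    sliceWeight k N ρ p = ENNReal.ofReal (p ^ (k - 1) * √(ρ ^ 2 - p ^ 2) ^ N) :=
  indicator_of_mem (s := {x : ℝ × ℝ | x.2 ≤ x.1}) (a := (ρ, p)) h _

theorem sliceWeight_of_lt {k N : ℕ} {ρ p : ℝ} (h : ρ < p) : sliceWeight k N ρ p = 0 :=
  indicator_of_notMem (s := {x : ℝ × ℝ | x.2 ≤ x.1}) (a := (ρ, p)) (not_le.2 h) _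

/-- With `ρ` as the outer variable, `c` affects only the range of `p`. -/
theorem radialVolume_eq (k N : ℕ) (α c : ℝ) :
    radialVolume k N α c = ∫⁻ ρ in Ioi (0 : ℝ), ∫⁻ p in Ioi (0 : ℝ),
      ENNReal.ofReal ρ * (sliceWeight k N ρ p * coneInd α (c * p) ρ) := by
  have hmeas : Measurable fun x : ℝ × ℝ => coneInd α (c * x.1) x.2 :=
    (measurable_coneInd α).comp ((measurable_fst.const_mul c).prodMk measurable_snd)
  have hmeas' : Measurable fun x : ℝ × ℝ => sliceWeight k N x.2 x.1 :=
    (measurable_sliceWeight k N).comp measurable_swap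
  rw [← lintegral_lintegral_swap (Measurable.aemeasurable (by
    simp only [Function.uncurry_def]; fun_prop))]
  refine setLIntegral_congr_fun measurableSet_Ioi fun p hp => ?_
  have hp : 0 < p := hp
  rw [lintegral_sqrt_add_sq N hp, ← lintegral_const_mul' _ _ ENNReal.ofReal_ne_top,
    restrict_Ioi_eq_restrict_Ici, ← lintegral_indicator measurableSet_Ici,
    ← lintegral_indicator measurableSet_Ioi]
  congr 1
  ext ρ
  rcases le_or_gt p ρ with h | h
  · rw [indicator_of_mem (show ρ ∈ Ici p from h),
      indicator_of_mem (show ρ ∈ Ioi (0 : ℝ) from hp.trans_le h), sliceWeight_of_le h, ← mul_assoc,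
      ← mul_assoc, ← ENNReal.ofReal_mul (by positivity),
      ← ENNReal.ofReal_mul (hp.le.trans h)]
    congr 2
    ring
  · rw [indicator_of_notMem (show ρ ∉ Ici p from not_le.2 h)]
    by_cases hρ : 0 < ρ <;> simp [indicator, hρ, sliceWeight_of_lt h]

theorem lintegral_sliceWeight {k N : ℕ} {α c ρ : ℝ} (hc : 0 < c) (hρ : 0 < ρ) :
    ∫⁻ p in Ioi (0 : ℝ), sliceWeight k N ρ p * coneInd α (c * p) ρ =
      (Iic (1 : ℝ)).indicator 1 ρ * ∫⁻ p in Icc (ρ / c) (α * (ρ / c)), sliceWeight k N ρ p := by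
  rw [← lintegral_const_mul' _ _ (by by_cases h : ρ ∈ Iic (1 : ℝ) <;> simp [h]),
    ← lintegral_indicator measurableSet_Ioi, ← lintegral_indicator measurableSet_Icc]
  congr 1
  ext p
  have h1 : ρ / c ≤ p ↔ ρ ≤ c * p := by rw [div_le_iff₀ hc, mul_comm]
  have h2 : p ≤ α * (ρ / c) ↔ c * p ≤ α * ρ := by
    rw [← mul_div_assoc, le_div_iff₀ hc, mul_comm]
  by_cases hp : 0 < p
  · by_cases hr : ρ ≤ 1 <;> by_cases ha : ρ ≤ c * p <;> by_cases hb : c * p ≤ α * ρ <;>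
      simp [coneInd, indicator, h1, h2, hp, hr, ha, hb]
  · have : ¬ ρ ≤ c * p := fun h => hp (by by_contra h'; nlinarith)
    simp [indicator, h1, hp, this]

theorem radialVolume_le {α : ℝ} (hα : 1 < α) {k : ℕ} (hk : 1 ≤ k) (N : ℕ) (c : ℝ) :
    radialVolume k N α c ≤ radialVolume k N α (sigmaMax (k + N + 3) k α) := by
  have hα0 : 0 < α := one_pos.trans hα
  obtain ⟨hσ, hcmp⟩ := sigmaMax_pos_and_compare hα hk N
  rw [radialVolume_eq, radialVolume_eq]
  refine setLIntegral_mono' measurableSet_Ioi fun ρ hρ => ?_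
  have hρ : 0 < ρ := hρ
  rw [lintegral_const_mul' _ _ ENNReal.ofReal_ne_top, lintegral_const_mul' _ _ ENNReal.ofReal_ne_top]
  gcongr ENNReal.ofReal ρ * ?_
  -- For `c ≤ 0` the range of `p` is empty; `c = 0` does occur, at directions killed by `u`.
  rcases le_or_gt c 0 with hc | hc
  · refine le_of_eq_of_le ?_ zero_le
    rw [setLIntegral_congr_fun measurableSet_Ioi (g := fun _ => 0) fun p hp => ?_, lintegral_zero]
    have hp : 0 < p := hp
    have : ¬ ρ ≤ c * p := by
      have := mul_nonpos_of_nonpos_of_nonneg hc hp.le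
      linarith
    simp [coneInd, this]
  rw [lintegral_sliceWeight hc hρ, lintegral_sliceWeight hσ hρ]
  gcongr _ * ?_
  -- The Jacobian `α` of the dilation completes `α^(k-1)` to `α^k`.
  have hpk : ∀ p : ℝ, α * (α * p) ^ (k - 1) = α ^ k * p ^ (k - 1) := fun p => by
    rw [mul_pow, ← mul_assoc, mul_comm α, pow_sub_one_mul (by omega)]
  refine setLIntegral_Icc_mul_le hα (div_pos hρ hσ) (div_pos hρ hc)
    (C := ENNReal.ofReal (ρ ^ (k - 1) * ρ ^ N)) ENNReal.ofReal_ne_top ?_ ?_ ?_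
  · intro p hp
    rcases le_or_gt p ρ with h | h
    · rw [sliceWeight_of_le h]
      gcongr
      refine Real.sqrt_le_iff.2 ⟨hρ.le, ?_⟩
      nlinarith
    · simp [sliceWeight_of_lt h]
  · intro p hp hps
    obtain ⟨h1, h2⟩ := (hcmp ρ p hρ hp).1 hps
    have hp' : p ≤ ρ := by nlinarith
    rw [sliceWeight_of_le h1, sliceWeight_of_le hp', ← ENNReal.ofReal_mul hα0.le, ← mul_assoc, hpk,
      mul_comm (α ^ k), mul_assoc]
    gcongr
  · intro p hsp
    have hp : 0 < p := (div_pos hρ hσ).trans hsp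
    rcases le_or_gt (α * p) ρ with h | h
    · have h2 := (hcmp ρ p hρ hp).2 hsp h
      have hp' : p ≤ ρ := by nlinarith
      rw [sliceWeight_of_le h, sliceWeight_of_le hp', ← ENNReal.ofReal_mul hα0.le, ← mul_assoc, hpk,
        mul_comm (α ^ k), mul_assoc]
      gcongr
    · simp [sliceWeight_of_lt h]

end JLOptimal

/-! ### Cone volumes in polar coordinates -/

namespace JLOptimal

open Set Metric Module

section Polar

variable {E : Type*} [NormedAddCommGroup E] [NormedSpace ℝ E] [FiniteDimensional ℝ E]
  [MeasurableSpace E] [BorelSpace E] [Nontrivial E] (μ : Measure E) [μ.IsAddHaarMeasure]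

/-- Integration in polar coordinates. -/
theorem lintegral_polar {f : E → ℝ≥0∞} (hf : Measurable f) :
    ∫⁻ x, f x ∂μ = ∫⁻ θ : sphere (0 : E) 1, (∫⁻ r in Ioi (0 : ℝ),
      ENNReal.ofReal (r ^ (finrank ℝ E - 1)) * f (r • (θ : E))) ∂μ.toSphere := by
  have hsm : Measurable fun x : sphere (0 : E) 1 × Ioi (0 : ℝ) => f ((x.2 : ℝ) • (x.1 : E)) := by
    refine hf.comp (Continuous.measurable ?_)
    fun_prop
  have h := μ.measurePreserving_homeomorphUnitSphereProd.lintegral_comp_emb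
    (Homeomorph.measurableEmbedding _) (fun x => f ((x.2 : ℝ) • (x.1 : E)))
  calc ∫⁻ x, f x ∂μ = ∫⁻ x : ({0}ᶜ : Set E), f x ∂(μ.comap (↑)) := by
        rw [lintegral_subtype_comap (measurableSet_singleton _).compl f, restrict_compl_singleton]
    _ = ∫⁻ x : sphere (0 : E) 1 × Ioi (0 : ℝ), f ((x.2 : ℝ) • (x.1 : E))
          ∂μ.toSphere.prod (.volumeIoiPow (finrank ℝ E - 1)) := by
        rw [← h]
        refine lintegral_congr fun x => ?_
        have hx : ‖(x : E)‖ ≠ 0 := norm_ne_zero_iff.2 x.2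
        simp [smul_smul, hx]
    _ = _ := by
        rw [lintegral_prod _ hsm.aemeasurable]
        refine lintegral_congr fun θ => ?_
        exact (lintegral_withDensity_eq_lintegral_mul _ (by fun_prop)
          (g := fun r : Ioi (0 : ℝ) => f ((r : ℝ) • (θ : E)))
          (hsm.comp measurable_prodMk_left)).trans (lintegral_subtype_comap measurableSet_Ioi
            fun r => ENNReal.ofReal (r ^ (finrank ℝ E - 1)) * f (r • (θ : E)))

theorem lintegral_fun_norm {h : ℝ → ℝ≥0∞} (hh : Measurable h) :
    ∫⁻ x, h ‖x‖ ∂μ = μ.toSphere univ *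
      ∫⁻ r in Ioi (0 : ℝ), ENNReal.ofReal (r ^ (finrank ℝ E - 1)) * h r := by
  rw [lintegral_polar μ (f := fun x => h ‖x‖) (hh.comp measurable_norm), mul_comm, ← lintegral_const]
  refine lintegral_congr fun θ => setLIntegral_congr_fun measurableSet_Ioi fun r hr => ?_
  have hr : 0 < r := hr
  simp [norm_smul, abs_of_pos hr]

end Polar

/-- The points `x` at which the linear map `g` satisfies `‖x‖ ≤ ‖g x‖ ≤ α ‖x‖`. -/
def stretchCone {E F : Type*} [Norm E] [Norm F] (g : E → F) (α : ℝ) : Set E :=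
  {x | ‖x‖ ≤ ‖g x‖ ∧ ‖g x‖ ≤ α * ‖x‖}

theorem isClosed_stretchCone {E F : Type*} [NormedAddCommGroup E] [InnerProductSpace ℝ E]
    [FiniteDimensional ℝ E] [NormedAddCommGroup F] [NormedSpace ℝ F] (g : E →ₗ[ℝ] F) (α : ℝ) : IsClosed (stretchCone g α) := by
  have hg : Continuous g := g.continuous_of_finiteDimensional
  exact (isClosed_le continuous_norm hg.norm).and (isClosed_le hg.norm (by fun_prop))

section Volume

variable {E F Y W : Type*} [NormedAddCommGroup E] [InnerProductSpace ℝ E] [FiniteDimensional ℝ E]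
  [MeasurableSpace E] [BorelSpace E] [NormedAddCommGroup F] [NormedSpace ℝ F]
  [NormedAddCommGroup Y] [InnerProductSpace ℝ Y] [FiniteDimensional ℝ Y]
  [MeasurableSpace Y] [BorelSpace Y] [Nontrivial Y]
  [NormedAddCommGroup W] [InnerProductSpace ℝ W] [FiniteDimensional ℝ W]
  [MeasurableSpace W] [BorelSpace W] [Nontrivial W]

/-- The volume of the part of a stretch cone in the unit ball, for a map that factors through the
first component of an orthogonal decomposition. -/
theorem volume_stretchCone (b : E ≃ₗᵢ[ℝ] WithLp 2 (Y × W)) (g : E →ₗ[ℝ] F) (u : Y →ₗ[ℝ] F)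
    (hg : ∀ x, g x = u (b x).fst) (α : ℝ) {N : ℕ} (hW : finrank ℝ W = N + 2) :
    volume (closedBall 0 1 ∩ stretchCone g α) = ∫⁻ θ : sphere (0 : Y) 1,
      (volume : Measure W).toSphere univ * radialVolume (finrank ℝ Y) N α ‖u θ‖
        ∂(volume : Measure Y).toSphere := by
  have hu : Continuous u := u.continuous_of_finiteDimensional
  have hmp := (WithLp.volume_preserving_toLp Y W)
  have hmpE := b.symm.measurePreserving
  have hgc : Continuous g := g.continuous_of_finiteDimensional
  have hci := measurable_coneInd α
  have hcomp := hmpE.comp hmp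
  have hpair : Measurable fun z : Y × W => coneInd α ‖u z.1‖ √(‖z.1‖ ^ 2 + ‖z.2‖ ^ 2) :=
    hci.comp (g := fun x : ℝ × ℝ => coneInd α x.1 x.2)
      (f := fun z : Y × W => (‖u z.1‖, √(‖z.1‖ ^ 2 + ‖z.2‖ ^ 2)))
      (Continuous.measurable (by fun_prop))
  have hpairE : Measurable fun x : E => coneInd α ‖g x‖ ‖x‖ :=
    hci.comp (g := fun x : ℝ × ℝ => coneInd α x.1 x.2) (f := fun x : E => (‖g x‖, ‖x‖))
      (Continuous.measurable (by fun_prop))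
  have hinner : Measurable fun y : Y => ∫⁻ w : W, coneInd α ‖u y‖ √(‖y‖ ^ 2 + ‖w‖ ^ 2) :=
    hpair.lintegral_prod_right'
  calc volume (closedBall 0 1 ∩ stretchCone g α) = ∫⁻ x : E, coneInd α ‖g x‖ ‖x‖ := by
        rw [← lintegral_indicator_one
          (isClosed_closedBall.inter (isClosed_stretchCone g α)).measurableSet]
        refine lintegral_congr fun x => ?_
        simp [coneInd, indicator, stretchCone]
    _ = ∫⁻ z : Y × W, coneInd α ‖u z.1‖ √(‖z.1‖ ^ 2 + ‖z.2‖ ^ 2) := by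
        rw [← hcomp.lintegral_comp hpairE]
        refine lintegral_congr fun z => ?_
        simp [hg, WithLp.prod_norm_eq_of_L2]
    _ = ∫⁻ y : Y, ∫⁻ w : W, coneInd α ‖u y‖ √(‖y‖ ^ 2 + ‖w‖ ^ 2) :=
        lintegral_prod _ hpair.aemeasurable
    _ = _ := by
        rw [lintegral_polar _ hinner]
        refine lintegral_congr fun θ => ?_
        -- On the ray `y = p θ`, `‖u y‖ = p ‖u θ‖`, so `u` enters only through `‖u θ‖`.
        rw [radialVolume, ← lintegral_const_mul' _ _ (measure_ne_top _ _)]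
        refine setLIntegral_congr_fun measurableSet_Ioi fun p hp => ?_
        have hp : 0 < p := hp
        have hθ : ‖(θ : Y)‖ = 1 := norm_eq_of_mem_sphere θ
        have h := lintegral_fun_norm (volume : Measure W)
          (h := fun q => coneInd α (‖u θ‖ * p) √(p ^ 2 + q ^ 2))
          (hci.comp (g := fun x : ℝ × ℝ => coneInd α x.1 x.2)
            (f := fun q : ℝ => (‖u θ‖ * p, √(p ^ 2 + q ^ 2))) (by fun_prop))
        rw [hW] at h
        simp only [map_smul, norm_smul, Real.norm_eq_abs, abs_of_pos hp, hθ, mul_one,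
          mul_comm p ‖u θ‖]
        rw [h, mul_left_comm]
        rfl

end Volume

end JLOptimal

/-! ### Haar measure on the orthogonal group and cones -/

namespace JLOptimal

open Set Metric Module

instance instSecondCountableTopologyMatrix (p q : ℕ) :
    SecondCountableTopology (Matrix (Fin p) (Fin q) ℝ) :=
  inferInstanceAs (SecondCountableTopology (Fin p → Fin q → ℝ))

/-- A right translate is again left-invariant, hence a multiple of the Haar measure, and total mass
`1` forces the factor `1`. -/
instance instIsMulRightInvariantHaarOrthogonal (m : ℕ) :
    (haarOrthogonal m).IsMulRightInvariant := by
  refine ⟨fun g => ?_⟩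
  have hp : IsProbabilityMeasure ((haarOrthogonal m).map (· * g)) :=
    Measure.isProbabilityMeasure_map (measurable_mul_const g).aemeasurable
  have h := Measure.isMulInvariant_eq_smul_of_compactSpace
    ((haarOrthogonal m).map (· * g)) (haarOrthogonal m)
  have h1 := congrArg (fun μ => μ univ) h
  simp only [measure_univ, Measure.smul_apply] at h1
  rw [ENNReal.smul_def, smul_eq_mul, mul_one, eq_comm, ENNReal.coe_eq_one] at h1
  rw [h, h1, one_smul]

/-- The isometry of Euclidean space given by an orthogonal matrix. -/
noncomputable def orthogonalIsometry {m : ℕ} (O : Matrix.orthogonalGroup (Fin m) ℝ) :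
    EuclideanSpace ℝ (Fin m) ≃ₗᵢ[ℝ] EuclideanSpace ℝ (Fin m) :=
  Unitary.linearIsometryEquiv ⟨Matrix.toEuclideanCLM (𝕜 := ℝ) O, Unitary.map_mem _ O.2⟩

theorem orthogonalIsometry_apply {m : ℕ} (O : Matrix.orthogonalGroup (Fin m) ℝ)
    (x : EuclideanSpace ℝ (Fin m)) :
    orthogonalIsometry O x = Matrix.toEuclideanLin (O : Matrix (Fin m) (Fin m) ℝ) x := rfl

theorem orthogonalIsometry_mul {m : ℕ} (O V : Matrix.orthogonalGroup (Fin m) ℝ)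
    (x : EuclideanSpace ℝ (Fin m)) :
    orthogonalIsometry (O * V) x = orthogonalIsometry O (orthogonalIsometry V x) := by
  simp [orthogonalIsometry_apply, Matrix.toLpLin_mul_same]

/-- The orthogonal group acts transitively on spheres. -/
theorem exists_orthogonalIsometry_eq {m : ℕ} {u v : EuclideanSpace ℝ (Fin m)} (h : ‖u‖ = ‖v‖) :
    ∃ O : Matrix.orthogonalGroup (Fin m) ℝ, orthogonalIsometry O u = v := by
  let R := Submodule.reflection (ℝ ∙ (u - v))ᗮ
  have hR : R u = v := Submodule.reflection_sub h
  let e := Matrix.toEuclideanCLM (𝕜 := ℝ) (n := Fin m)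
  let O : Matrix.orthogonalGroup (Fin m) ℝ :=
    ⟨e.symm (Unitary.linearIsometryEquiv.symm R : _ →L[ℝ] _),
      Unitary.map_mem e.symm (Unitary.linearIsometryEquiv.symm R).2⟩
  refine ⟨O, ?_⟩
  rw [← hR]
  change e (e.symm (Unitary.linearIsometryEquiv.symm R : _ →L[ℝ] _)) u = R u
  rw [StarAlgEquiv.apply_symm_apply]
  rfl

theorem continuous_toEuclideanLin {p q : ℕ} :
    Continuous fun x : Matrix (Fin p) (Fin q) ℝ × EuclideanSpace ℝ (Fin q) =>
      Matrix.toEuclideanLin x.1 x.2 := by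
  simp only [Matrix.toLpLin_apply]
  refine (PiLp.continuous_toLp 2 _).comp (continuous_fst.matrix_mulVec ?_)
  exact (PiLp.continuous_ofLp 2 _).comp continuous_snd

theorem continuous_orthogonalIsometry {m : ℕ} :
    Continuous fun x : Matrix.orthogonalGroup (Fin m) ℝ × EuclideanSpace ℝ (Fin m) =>
      orthogonalIsometry x.1 x.2 := by
  refine continuous_toEuclideanLin.comp (f := fun x :
    Matrix.orthogonalGroup (Fin m) ℝ × EuclideanSpace ℝ (Fin m) =>
      ((x.1 : Matrix (Fin m) (Fin m) ℝ), x.2)) ?_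
  fun_prop

/-- The orbit of a unit vector under a random rotation is uniformly distributed on the sphere, in
the sense that it gives to a cone the proportion of the unit ball that lies in this cone. -/
theorem haarOrthogonal_cone {m : ℕ} {S : Set (EuclideanSpace ℝ (Fin m))} (hS : MeasurableSet S)
    (hcone : ∀ c : ℝ, 0 < c → ∀ x, c • x ∈ S ↔ x ∈ S) {z : EuclideanSpace ℝ (Fin m)}
    (hz : ‖z‖ = 1) :
    haarOrthogonal m {O | orthogonalIsometry O z ∈ S} *
        volume (closedBall (0 : EuclideanSpace ℝ (Fin m)) 1) = volume (closedBall 0 1 ∩ S) := by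
  -- Right invariance moves `z` to the direction of `x`, and the cone property absorbs the length.
  have hconst : ∀ x : EuclideanSpace ℝ (Fin m), x ≠ 0 →
      haarOrthogonal m {O | orthogonalIsometry O x ∈ S} =
        haarOrthogonal m {O | orthogonalIsometry O z ∈ S} := fun x hx => by
    have hx' : 0 < ‖x‖ := norm_pos_iff.2 hx
    obtain ⟨V, hV⟩ := exists_orthogonalIsometry_eq (u := z) (v := ‖x‖⁻¹ • x)
      (by rw [norm_smul, norm_inv, norm_norm, inv_mul_cancel₀ hx'.ne', hz])
    rw [← measure_preimage_mul_right (haarOrthogonal m) V {O | orthogonalIsometry O z ∈ S}]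
    congr 1
    ext O
    simp only [mem_ofPred_eq, mem_preimage]
    rw [orthogonalIsometry_mul, hV, map_smul, hcone _ (inv_pos.2 hx')]
  -- The product measure of `T` is computed both ways: slices at fixed `O` have constant volume
  -- since `O` is an isometry, slices at fixed `x ≠ 0` by `hconst`.
  let T : Set (Matrix.orthogonalGroup (Fin m) ℝ × EuclideanSpace ℝ (Fin m)) :=
    {q | q.2 ∈ closedBall 0 1 ∧ orthogonalIsometry q.1 q.2 ∈ S}
  have hT : MeasurableSet T := (measurable_snd isClosed_closedBall.measurableSet).inter
    (continuous_orthogonalIsometry.measurable hS)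
  have h1 : ((haarOrthogonal m).prod volume) T = volume (closedBall 0 1 ∩ S) := by
    rw [Measure.prod_apply hT]
    have : ∀ O : Matrix.orthogonalGroup (Fin m) ℝ,
        volume (Prod.mk O ⁻¹' T) = volume (closedBall 0 1 ∩ S) := fun O => by
      rw [← (orthogonalIsometry O).measurePreserving.measure_preimage
        (isClosed_closedBall.measurableSet.inter hS).nullMeasurableSet]
      congr 1
      ext x
      simp [T]
    simp [this]
  have h2 : ((haarOrthogonal m).prod volume) T =
      haarOrthogonal m {O | orthogonalIsometry O z ∈ S} *
        volume (closedBall (0 : EuclideanSpace ℝ (Fin m)) 1) := by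
    have hz0 : z ≠ 0 := norm_ne_zero_iff.1 (by simp [hz])
    have : Nontrivial (EuclideanSpace ℝ (Fin m)) := ⟨z, 0, hz0⟩
    rw [Measure.prod_apply_symm hT, ← setLIntegral_const, ← lintegral_indicator
      isClosed_closedBall.measurableSet]
    refine lintegral_congr_ae ?_
    filter_upwards [Measure.ae_ne volume (0 : EuclideanSpace ℝ (Fin m))] with x hx
    by_cases hxB : x ∈ closedBall (0 : EuclideanSpace ℝ (Fin m)) 1
    · rw [indicator_of_mem hxB, ← hconst x hx]
      congr 1
      ext O
      simp only [T, mem_preimage, mem_ofPred_eq, hxB, true_and]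
    · rw [indicator_of_notMem hxB]
      convert measure_empty (μ := haarOrthogonal m)
      ext O
      simp only [T, mem_preimage, mem_ofPred_eq, hxB, false_and, mem_empty_iff_false]
  rw [← h2, h1]

theorem smul_mem_stretchCone {E F : Type*} [NormedAddCommGroup E] [NormedSpace ℝ E]
    [NormedAddCommGroup F] [NormedSpace ℝ F] (g : E →ₗ[ℝ] F) (α : ℝ) {c : ℝ} (hc : 0 < c) (x : E) :
    c • x ∈ stretchCone g α ↔ x ∈ stretchCone g α := by
  simp only [stretchCone, mem_ofPred_eq, map_smul, norm_smul, Real.norm_eq_abs, abs_of_pos hc,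
    mul_left_comm α c, mul_le_mul_iff_of_pos_left hc]

theorem mem_stretchCone_of_norm_eq_one {E F : Type*} [Norm E] [Norm F] (g : E → F) (α : ℝ) {x : E}
    (hx : ‖x‖ = 1) : x ∈ stretchCone g α ↔ 1 ≤ ‖g x‖ ∧ ‖g x‖ ≤ α := by
  simp [stretchCone, hx]

/-! ### Reduction of matrices to their radial profile -/

/-- A linear map from `ℝ^(k+d)` to `ℝ^k` factors through the projection to a `k`-dimensional
subspace. -/
theorem exists_isometry_factor {k d : ℕ}
    (g : EuclideanSpace ℝ (Fin (k + d)) →ₗ[ℝ] EuclideanSpace ℝ (Fin k)) :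
    ∃ (b : EuclideanSpace ℝ (Fin (k + d)) ≃ₗᵢ[ℝ]
        WithLp 2 (EuclideanSpace ℝ (Fin k) × EuclideanSpace ℝ (Fin d)))
      (u : EuclideanSpace ℝ (Fin k) →ₗ[ℝ] EuclideanSpace ℝ (Fin k)),
      ∀ x, g x = u (b x).fst := by
  have hker : d ≤ finrank ℝ (LinearMap.ker g) := by
    have h1 := g.finrank_range_add_finrank_ker
    have h2 := Submodule.finrank_le (LinearMap.range g)
    rw [finrank_euclideanSpace_fin] at h1 h2
    omega
  -- The kernel exceeds dimension `d` when `g` is rank-deficient; only `d` of its basis vectors are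
  -- used, and the others may be left to `u`.
  let w := stdOrthonormalBasis ℝ (LinearMap.ker g)
  let v : Fin k ⊕ Fin d → EuclideanSpace ℝ (Fin (k + d)) :=
    Sum.elim (fun _ => 0) fun i => w (Fin.castLE hker i)
  have hv : Orthonormal ℝ ((range Sum.inr).domRestrict v) := by
    have h1 : Orthonormal ℝ ((LinearMap.ker g).subtypeₗᵢ ∘ w ∘ Fin.castLE hker) :=
      (w.orthonormal.comp _ (Fin.castLE_injective hker)).comp_linearIsometry
        (LinearMap.ker g).subtypeₗᵢ
    have h2 := h1.comp (Equiv.ofInjective (Sum.inr : Fin d → Fin k ⊕ Fin d)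
      Sum.inr_injective).symm (Equiv.injective _)
    convert h2 using 1
    ext1 ⟨_, i, rfl⟩
    simp [v, Function.comp_def]
  obtain ⟨B, hB⟩ := hv.exists_orthonormalBasis_extension_of_card_eq (by simp)
  have hBg : ∀ i, g (B (Sum.inr i)) = 0 := fun i => by
    rw [hB _ (mem_range_self i)]
    exact (w (Fin.castLE hker i)).2
  refine ⟨B.repr.trans (PiLp.sumPiLpEquivProdLpPiLp 2 fun _ => ℝ),
    Fintype.linearCombination ℝ (fun j => g (B (Sum.inl j))) ∘ₗ
      (WithLp.linearEquiv 2 ℝ (Fin k → ℝ)).toLinearMap, fun x => ?_⟩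
  conv_lhs => rw [← B.sum_repr x]
  simp [hBg, Fintype.linearCombination_apply]
  rfl

/-- The projection to the first `k` coordinates is the first component of an isometry. -/
theorem exists_isometry_projMatrix (k d : ℕ) :
    ∃ b : EuclideanSpace ℝ (Fin (k + d)) ≃ₗᵢ[ℝ]
        WithLp 2 (EuclideanSpace ℝ (Fin k) × EuclideanSpace ℝ (Fin d)),
      ∀ x, Matrix.toEuclideanLin (projMatrix k (k + d)) x = (b x).fst := by
  refine ⟨((EuclideanSpace.basisFun (Fin (k + d)) ℝ).reindex finSumFinEquiv.symm).repr.trans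
    (PiLp.sumPiLpEquivProdLpPiLp 2 fun _ => ℝ), fun x => ?_⟩
  ext j
  simp only [Matrix.toLpLin_apply, Matrix.mulVec, dotProduct, projMatrix]
  rw [Finset.sum_eq_single (Fin.castAdd d j)]
  · have h : ((EuclideanSpace.basisFun (Fin (k + d)) ℝ).reindex finSumFinEquiv.symm).repr x
        (Sum.inl j) = x (Fin.castAdd d j) := by simp
    simp only [Matrix.of_apply, Fin.val_castAdd, if_true, one_mul]
    exact h.symm
  · intro i _ hi
    have : ¬ (j : ℕ) = i := fun h => hi (Fin.ext h.symm)
    simp [this]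
  · simp

/-- The scaled projection has the largest stretch cone. -/
theorem volume_stretchCone_le {α : ℝ} (hα : 1 < α) {k : ℕ} (hk : 1 ≤ k) (N : ℕ)
    (A : Matrix (Fin k) (Fin (k + (N + 2))) ℝ) :
    volume (closedBall 0 1 ∩ stretchCone (Matrix.toEuclideanLin A) α) ≤
      volume (closedBall 0 1 ∩ stretchCone (Matrix.toEuclideanLin
        (sigmaMax (k + N + 3) k α • projMatrix k (k + (N + 2)))) α) := by
  have : Nontrivial (EuclideanSpace ℝ (Fin k)) :=
    nontrivial_of_finrank_pos (R := ℝ) (by rw [finrank_euclideanSpace_fin]; omega)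
  have hW : finrank ℝ (EuclideanSpace ℝ (Fin (N + 2))) = N + 2 := finrank_euclideanSpace_fin
  have : Nontrivial (EuclideanSpace ℝ (Fin (N + 2))) :=
    nontrivial_of_finrank_pos (R := ℝ) (by omega)
  obtain ⟨b, u, hu⟩ := exists_isometry_factor (Matrix.toEuclideanLin A)
  obtain ⟨b₀, hb₀⟩ := exists_isometry_projMatrix k (N + 2)
  have hσ := (sigmaMax_pos_and_compare hα hk N).1
  rw [volume_stretchCone b _ u hu α hW,
    volume_stretchCone b₀ _ (sigmaMax (k + N + 3) k α • LinearMap.id)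
      (fun x => by simp [← hb₀]) α hW]
  -- For the scaled projection `‖u θ‖ = sigmaMax` for every `θ`, so the integrands compare
  -- pointwise.
  refine lintegral_mono fun θ => ?_
  have hθ : ‖(θ : EuclideanSpace ℝ (Fin k))‖ = 1 := norm_eq_of_mem_sphere θ
  gcongr _ * ?_
  rw [finrank_euclideanSpace_fin, LinearMap.smul_apply, LinearMap.id_apply, norm_smul, hθ, mul_one,
    Real.norm_eq_abs, abs_of_pos hσ]
  exact radialVolume_le hα hk N _

theorem haarOrthogonal_stretchCone {m k : ℕ} (A : Matrix (Fin k) (Fin m) ℝ) (α : ℝ)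
    {z : EuclideanSpace ℝ (Fin m)} (hz : ‖z‖ = 1) :
    haarOrthogonal m {O | 1 ≤ ‖Matrix.toEuclideanLin A (orthogonalIsometry O z)‖ ∧
        ‖Matrix.toEuclideanLin A (orthogonalIsometry O z)‖ ≤ α} =
      volume (closedBall 0 1 ∩ stretchCone (Matrix.toEuclideanLin A) α) /
        volume (closedBall (0 : EuclideanSpace ℝ (Fin m)) 1) := by
  rw [← haarOrthogonal_cone (isClosed_stretchCone _ α).measurableSet
    (fun c hc x => smul_mem_stretchCone _ α hc x) hz, ENNReal.mul_div_cancel_right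
      (measure_closedBall_pos _ _ one_pos).ne' measure_closedBall_lt_top.ne]
  congr 1
  ext O
  have hO : ‖orthogonalIsometry O z‖ = 1 := by rw [LinearIsometryEquiv.norm_map, hz]
  exact (mem_stretchCone_of_norm_eq_one _ α hO).symm

/-! ### Averaging over rotations and conclusion -/

/-- Averaging over rotations bounds the worst-case probability by the supremum of the
probabilities that a random rotation of a fixed vector is suitable for a fixed matrix. -/
theorem worstCaseProb_le {m k : ℕ} (hm : 0 < m) (α : ℝ) (ν : Measure (Matrix (Fin k) (Fin m) ℝ))
    [IsProbabilityMeasure ν] {C : ℝ≥0∞}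
    (hC : ∀ (A : Matrix (Fin k) (Fin m) ℝ) (z : EuclideanSpace ℝ (Fin m)), ‖z‖ = 1 →
      haarOrthogonal m {O | 1 ≤ ‖Matrix.toEuclideanLin A (orthogonalIsometry O z)‖ ∧
        ‖Matrix.toEuclideanLin A (orthogonalIsometry O z)‖ ≤ α} ≤ C) :
    worstCaseProb α ν ≤ C := by
  let z : EuclideanSpace ℝ (Fin m) := EuclideanSpace.single ⟨0, hm⟩ 1
  have hz : ‖z‖ = 1 := by simp [z]
  let T : Set (Matrix.orthogonalGroup (Fin m) ℝ × Matrix (Fin k) (Fin m) ℝ) :=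
    {q | 1 ≤ ‖Matrix.toEuclideanLin q.2 (orthogonalIsometry q.1 z)‖ ∧
      ‖Matrix.toEuclideanLin q.2 (orthogonalIsometry q.1 z)‖ ≤ α}
  have hcont : Continuous fun q : Matrix.orthogonalGroup (Fin m) ℝ × Matrix (Fin k) (Fin m) ℝ =>
      ‖Matrix.toEuclideanLin q.2 (orthogonalIsometry q.1 z)‖ := by
    refine (continuous_toEuclideanLin.comp (continuous_snd.prodMk
      (continuous_orthogonalIsometry.comp (continuous_fst.prodMk continuous_const)))).norm
  have hT : MeasurableSet T :=
    ((isClosed_le continuous_const hcont).and (isClosed_le hcont continuous_const)).measurableSet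
  calc worstCaseProb α ν = ∫⁻ _ : Matrix.orthogonalGroup (Fin m) ℝ, worstCaseProb α ν
        ∂haarOrthogonal m := by simp
    _ ≤ ∫⁻ O, ν (Prod.mk O ⁻¹' T) ∂haarOrthogonal m :=
        lintegral_mono fun O => iInf₂_le (orthogonalIsometry O z) (by simp [hz])
    _ = ∫⁻ A, haarOrthogonal m ((fun O => (O, A)) ⁻¹' T) ∂ν := by
        rw [← Measure.prod_apply hT, ← Measure.prod_apply_symm hT]
    _ ≤ ∫⁻ _, C ∂ν := lintegral_mono fun A => hC A z hz
    _ = C := by simp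

theorem measurable_smul_projMatrix_mul (k m : ℕ) (s : ℝ) :
    Measurable fun O : Matrix.orthogonalGroup (Fin m) ℝ =>
      s • (projMatrix k m * (O : Matrix (Fin m) (Fin m) ℝ)) :=
  ((continuous_const.matrix_mul continuous_subtype_val).const_smul s).measurable

instance instIsProbabilityMeasureScaledProjLaw (n k : ℕ) (α : ℝ) :
    IsProbabilityMeasure (scaledProjLaw n k α) :=
  Measure.isProbabilityMeasure_map (measurable_smul_projMatrix_mul _ _ _).aemeasurable

theorem scaledProjLaw_apply (n k : ℕ) (α : ℝ) (z : EuclideanSpace ℝ (Fin (n - 1))) :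
    scaledProjLaw n k α {A | 1 ≤ ‖Matrix.toEuclideanLin A z‖ ∧ ‖Matrix.toEuclideanLin A z‖ ≤ α} =
      haarOrthogonal (n - 1)
        {O | 1 ≤ ‖Matrix.toEuclideanLin (sigmaMax n k α • projMatrix k (n - 1))
            (orthogonalIsometry O z)‖ ∧
          ‖Matrix.toEuclideanLin (sigmaMax n k α • projMatrix k (n - 1))
            (orthogonalIsometry O z)‖ ≤ α} := by
  have hcont : Continuous fun A : Matrix (Fin k) (Fin (n - 1)) ℝ => ‖Matrix.toEuclideanLin A z‖ :=
    (continuous_toEuclideanLin.comp (continuous_id.prodMk continuous_const)).norm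
  rw [scaledProjLaw, Measure.map_apply (measurable_smul_projMatrix_mul _ _ _)
    ((isClosed_le continuous_const hcont).and (isClosed_le hcont continuous_const)).measurableSet]
  congr 1
  ext O
  simp only [mem_preimage, mem_ofPred_eq, ← Matrix.smul_mul, Matrix.toLpLin_mul_same,
    orthogonalIsometry_apply, LinearMap.comp_apply]

end JLOptimal

theorem proposition2p1 (α : ℝ) (hα : 1 < α) (n k : ℕ) (hn : 4 ≤ n) (hk : 1 ≤ k)
    (hkn : k + 3 ≤ n) :
    MeasureTheory.IsProbabilityMeasure (JLOptimal.scaledProjLaw n k α) ∧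
      JLOptimal.worstCaseProb α (JLOptimal.scaledProjLaw n k α) =
        JLOptimal.optimalProb k (n - 1) α := by
  refine ⟨inferInstance, le_antisymm (le_iSup₂_of_le _ inferInstance le_rfl) ?_⟩
  refine le_iInf₂ fun z hz => ?_
  rw [JLOptimal.scaledProjLaw_apply,
    JLOptimal.haarOrthogonal_stretchCone _ α (mem_sphere_zero_iff_norm.1 hz)]
  refine iSup₂_le fun ν hν => JLOptimal.worstCaseProb_le (by omega) α ν fun A w hw => ?_
  rw [JLOptimal.haarOrthogonal_stretchCone A α hw]
  refine ENNReal.div_le_div_right ?_ _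
  -- With this `N`, the dimension `n - 1` is definitionally `k + (N + 2)`.
  obtain ⟨N, rfl⟩ : ∃ N, n = k + N + 3 := ⟨n - k - 3, by omega⟩
  exact JLOptimal.volume_stretchCone_le hα hk N A
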